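/- Let $\mathbb{G}$ be a compact quantum group: a unital C*-algebra $A=C(\mathbb{G})$ with a coassociative unital *-homomorphism $\Delta:A\to A\otimes A$ (minimal tensor product) such that $(A\otimes 1)\Delta(A)$ and $(1\otimes A)\Delta(A)$ span dense subspaces of $A\otimes A$. Let $U$ be a finite-dimensional unitary representation of $\mathbb{G}$, written in an orthonormal basis as a unitary matrix $U=(u_{ij})\in M_n(A)$ with $\Delta(u_{ij})=\sum_k u_{ik}\otimes u_{kj}$. For matrices $V,W$ over $A$, let $\mathrm{Mor}(V,W)$ be the set of complex matrices $T$ with $(T\otimes 1)V=W(T\otimes 1)$; $V$ and $W$ are equivalent if $\mathrm{Mor}(V,W)$ contains an invertible $T$. The contragredient of $V$ is $V^{c}=(V^{-1})^{\top}$, the transpose of matrix indices. Let $\rho_U$ be the unique positive invertible element of $\mathrm{Mor}(U,U^{cc})$ with $\mathrm{Tr}(T\rho_U)=\mathrm{Tr}(T\rho_U^{-1})$ for all $T\in\mathrm{End}(U)=\mathrm{Mor}(U,U)$, and let $$\overline{U}=\bigl((\rho_U^{\top})^{1/2}\otimes 1\bigr)\,U^{c}\,\bigl((\rho_U^{\top})^{-1/2}\otimes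 1\bigr)$$ be the conjugate representation of $U$. If $U$ and $\overline{U}$ are equivalent, then $\rho_U$ has symmetric eigenvalues: the list of eigenvalues of $\rho_U$ and the list of eigenvalues of $\rho_U^{-1}$, each counted with multiplicities and written in descending order, are equal. -/

import Mathlib

open scoped TensorProduct ComplexOrder InnerProductSpace ENNReal MatrixOrder

noncomputable section

namespace CQG

universe u v w

attribute [local instance] CStarAlgebra.spectralOrder CStarAlgebra.spectralOrderedRing

/-! ## The minimal (spatial) tensor product of unital C*-algebras -/

section HilbertTensor

variable {H K : Type*} [NormedAddCommGroup H] [InnerProductSpace ℂ H]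
  [NormedAddCommGroup K] [InnerProductSpace ℂ K]

/-- The bounded operator `S ⊗ T` on the Hilbert space tensor product of `H` and `K`, the latter
being the completion of the algebraic tensor product. -/
def opTensor (S : H →L[ℂ] H) (T : K →L[ℂ] K) :
    UniformSpace.Completion (H ⊗[ℂ] K) →L[ℂ] UniformSpace.Completion (H ⊗[ℂ] K) :=
  (TensorProduct.mapL S T).completion

theorem opTensor_ext {F G : UniformSpace.Completion (H ⊗[ℂ] K) →L[ℂ]
      UniformSpace.Completion (H ⊗[ℂ] K)}
    (h : ∀ (x : H) (y : K), F (↑(x ⊗ₜ[ℂ] y : H ⊗[ℂ] K)) = G (↑(x ⊗ₜ[ℂ] y : H ⊗[ℂ] K))) :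
    F = G := by
  ext z
  induction z using UniformSpace.Completion.induction_on with
  | hp => exact isClosed_eq F.continuous G.continuous
  | ih z =>
    induction z using TensorProduct.induction_on with
    | zero => rw [UniformSpace.Completion.coe_zero, map_zero, map_zero]
    | tmul x y => exact h x y
    | add x y hx hy => simp only [UniformSpace.Completion.coe_add, map_add, hx, hy]

theorem opTensor_tmul (S : H →L[ℂ] H) (T : K →L[ℂ] K) (x : H) (y : K) :
    opTensor S T (↑(x ⊗ₜ[ℂ] y : H ⊗[ℂ] K)) = ↑(S x ⊗ₜ[ℂ] T y : H ⊗[ℂ] K) := by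
  simp [opTensor]

theorem norm_opTensor_le (S : H →L[ℂ] H) (T : K →L[ℂ] K) : ‖opTensor S T‖ ≤ ‖S‖ * ‖T‖ := by
  refine ContinuousLinearMap.opNorm_le_bound _ (by positivity) fun z => ?_
  induction z using UniformSpace.Completion.induction_on with
  | hp => exact isClosed_le (by fun_prop) (by fun_prop)
  | ih z =>
    simp only [opTensor, ContinuousLinearMap.completion_apply_coe, UniformSpace.Completion.norm_coe]
    exact (ContinuousLinearMap.le_opNorm _ z).trans
      (mul_le_mul_of_nonneg_right (TensorProduct.norm_mapL_le S T) (norm_nonneg z))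

theorem star_opTensor [CompleteSpace H] [CompleteSpace K] (S : H →L[ℂ] H) (T : K →L[ℂ] K) :
    star (opTensor S T) = opTensor (star S) (star T) := by
  symm
  refine (ContinuousLinearMap.eq_adjoint_iff _ _).mpr fun x y => ?_
  induction x, y using UniformSpace.Completion.induction_on₂ with
  | hp => exact isClosed_eq (by fun_prop) (by fun_prop)
  | ih x y =>
    simp only [opTensor, ContinuousLinearMap.completion_apply_coe, UniformSpace.Completion.inner_coe]
    induction x using TensorProduct.induction_on with
    | zero => simp
    | add x x' hx hx' => simp only [map_add, inner_add_left, hx, hx']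
    | tmul a b =>
      induction y using TensorProduct.induction_on with
      | zero => simp
      | add x x' hx hx' => simp only [map_add, inner_add_right, hx, hx']
      | tmul c d =>
        simp [ContinuousLinearMap.star_eq_adjoint, ContinuousLinearMap.adjoint_inner_left]

end HilbertTensor

section MinTensor

/-- The bounded operators on a Hilbert space form a unital C*-algebra. -/
instance instCStarOp {H : Type*} [NormedAddCommGroup H] [InnerProductSpace ℂ H] [CompleteSpace H] :
    CStarAlgebra (H →L[ℂ] H) where

/-- Bounded families in a product of non-zero unital C*-algebras form a unital C*-algebra. -/
instance instLp {I : Type*} {E : I → Type*} [∀ i, Nontrivial (E i)] [∀ i, CStarAlgebra (E i)] :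
    CStarAlgebra (lp E ∞) where

variable (A : Type u) (B : Type v) [CStarAlgebra A] [CStarAlgebra B]

/-- The Hilbert space tensor product of the GNS spaces of two positive functionals. -/
abbrev GNSTensor (p : (A →ₚ[ℂ] ℂ) × (B →ₚ[ℂ] ℂ)) : Type (max u v) :=
  UniformSpace.Completion (p.1.GNS ⊗[ℂ] p.2.GNS)

/-- Pairs of positive functionals for which this Hilbert space is non-zero. -/
abbrev FunctionalPair : Type (max u v) :=
  {p : (A →ₚ[ℂ] ℂ) × (B →ₚ[ℂ] ℂ) // Nontrivial (GNSTensor A B p)}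

/-- The C*-algebra of bounded operators on `GNSTensor A B p`. -/
def GNSOp (p : FunctionalPair A B) : Type (max u v) :=
  GNSTensor A B p.1 →L[ℂ] GNSTensor A B p.1

instance instNontrivialGNSTensor (p : FunctionalPair A B) : Nontrivial (GNSTensor A B p.1) := p.2

instance instCStarGNSOp (p : FunctionalPair A B) : CStarAlgebra (GNSOp A B p) :=
  inferInstanceAs (CStarAlgebra (GNSTensor A B p.1 →L[ℂ] GNSTensor A B p.1))

instance instNontrivialGNSOp (p : FunctionalPair A B) : Nontrivial (GNSOp A B p) :=
  inferInstanceAs (Nontrivial (GNSTensor A B p.1 →L[ℂ] GNSTensor A B p.1))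

/-- The C*-algebra of bounded families of operators on the spaces `GNSTensor A B p`. -/
def GNSProd : Type (max u v) := lp (GNSOp A B) ∞

instance instCStarGNSProd : CStarAlgebra (GNSProd A B) :=
  inferInstanceAs (CStarAlgebra (lp (GNSOp A B) ∞))

variable {A B}

/-- The operator `π_φ(a) ⊗ π_ψ(b)`, where `p = (φ, ψ)` and `π_φ`, `π_ψ` are the GNS
representations. -/
def gnsOp (p : FunctionalPair A B) (a : A) (b : B) : GNSOp A B p :=
  (opTensor (p.1.1.gnsStarAlgHom a) (p.1.2.gnsStarAlgHom b) :
    GNSTensor A B p.1 →L[ℂ] GNSTensor A B p.1)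

theorem norm_gnsOp_le (p : FunctionalPair A B) (a : A) (b : B) :
    ‖gnsOp p a b‖ ≤ ‖a‖ * ‖b‖ := by
  refine (norm_opTensor_le (p.1.1.gnsStarAlgHom a) (p.1.2.gnsStarAlgHom b)).trans ?_
  exact mul_le_mul (NonUnitalStarAlgHom.norm_apply_le p.1.1.gnsStarAlgHom a)
    (NonUnitalStarAlgHom.norm_apply_le p.1.2.gnsStarAlgHom b) (norm_nonneg _) (norm_nonneg _)

/-- The family of all operators `π_φ(a) ⊗ π_ψ(b)`. -/
def gnsFamily (a : A) (b : B) : GNSProd A B :=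
  ⟨fun p => gnsOp p a b, memℓp_infty ⟨‖a‖ * ‖b‖, by
    rintro _ ⟨p, rfl⟩; exact norm_gnsOp_le p a b⟩⟩

theorem gnsProd_ext {x y : GNSProd A B} (h : ∀ p, x.1 p = y.1 p) : x = y :=
  Subtype.ext (funext h)

theorem gnsOp_mul (p : FunctionalPair A B) (a a' : A) (b b' : B) :
    gnsOp p (a * a') (b * b') = gnsOp p a b * gnsOp p a' b' := by
  refine opTensor_ext fun x y => ?_
  change opTensor _ _ _ = opTensor _ _ (opTensor _ _ _)
  simp only [opTensor_tmul, map_mul]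
  rfl

theorem gnsOp_one (p : FunctionalPair A B) : gnsOp p 1 1 = 1 := by
  refine opTensor_ext fun x y => ?_
  change opTensor _ _ _ = _
  simp only [opTensor_tmul, map_one]
  rfl

theorem gnsOp_star (p : FunctionalPair A B) (a : A) (b : B) :
    gnsOp p (star a) (star b) = star (gnsOp p a b) := by
  change opTensor _ _ = star (opTensor _ _)
  rw [star_opTensor, map_star, map_star]

theorem gnsOp_add_left (p : FunctionalPair A B) (a a' : A) (b : B) :
    gnsOp p (a + a') b = gnsOp p a b + gnsOp p a' b := by
  refine opTensor_ext fun x y => ?_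
  change opTensor _ _ _ = opTensor _ _ _ + opTensor _ _ _
  simp only [opTensor_tmul, map_add, add_apply, TensorProduct.add_tmul,
    UniformSpace.Completion.coe_add]

theorem gnsOp_add_right (p : FunctionalPair A B) (a : A) (b b' : B) :
    gnsOp p a (b + b') = gnsOp p a b + gnsOp p a b' := by
  refine opTensor_ext fun x y => ?_
  change opTensor _ _ _ = opTensor _ _ _ + opTensor _ _ _
  simp only [opTensor_tmul, map_add, add_apply, TensorProduct.tmul_add,
    UniformSpace.Completion.coe_add]

theorem gnsOp_smul_left (p : FunctionalPair A B) (c : ℂ) (a : A) (b : B) :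
    gnsOp p (c • a) b = c • gnsOp p a b := by
  refine opTensor_ext fun x y => ?_
  change opTensor _ _ _ = c • opTensor _ _ _
  simp only [opTensor_tmul, map_smul, smul_apply, ← UniformSpace.Completion.coe_smul]
  rfl

theorem gnsOp_smul_right (p : FunctionalPair A B) (c : ℂ) (a : A) (b : B) :
    gnsOp p a (c • b) = c • gnsOp p a b := by
  refine opTensor_ext fun x y => ?_
  change opTensor _ _ _ = c • opTensor _ _ _
  simp only [opTensor_tmul, map_smul, smul_apply, TensorProduct.tmul_smul,
    UniformSpace.Completion.coe_smul]

variable (A B)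

/-- The algebra homomorphism underlying `algTensorHom`. -/
def algTensorAlgHom : A ⊗[ℂ] B →ₐ[ℂ] GNSProd A B :=
  Algebra.TensorProduct.algHomOfLinearMapTensorProduct
    (TensorProduct.lift (LinearMap.mk₂ ℂ (gnsFamily (A := A) (B := B))
      (fun a a' b => gnsProd_ext fun p => gnsOp_add_left p a a' b)
      (fun c a b => gnsProd_ext fun p => gnsOp_smul_left p c a b)
      (fun a b b' => gnsProd_ext fun p => gnsOp_add_right p a b b')
      (fun c a b => gnsProd_ext fun p => gnsOp_smul_right p c a b)))
    (fun a a' b b' => gnsProd_ext fun p => gnsOp_mul p a a' b b')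
    (gnsProd_ext fun p => gnsOp_one p)

theorem algTensorAlgHom_star (x : A ⊗[ℂ] B) :
    algTensorAlgHom A B (star x) = star (algTensorAlgHom A B x) := by
  induction x using TensorProduct.induction_on with
  | zero => rw [star_zero, map_zero, star_zero]
  | tmul a b => exact gnsProd_ext fun p => gnsOp_star p a b
  | add x y hx hy => rw [star_add, map_add, hx, hy, map_add, star_add]

/-- The *-homomorphism `a ⊗ b ↦ (π_φ(a) ⊗ π_ψ(b))_{φ, ψ}` on the algebraic tensor product, where
`φ`, `ψ` range over all positive functionals. As the direct sum of all GNS representations is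
faithful, the norm of the image of `x` is the minimal (spatial) C*-norm of `x`. -/
def algTensorHom : A ⊗[ℂ] B →⋆ₐ[ℂ] GNSProd A B :=
  { algTensorAlgHom A B with map_star' := algTensorAlgHom_star A B }

/-- The minimal (spatial) tensor product of the unital C*-algebras `A` and `B`: the completion of
the algebraic tensor product in the minimal C*-norm. -/
def MinTensor : Type (max u v) := (algTensorHom A B).range.topologicalClosure

instance instIsClosedMinTensor :
    IsClosed ((algTensorHom A B).range.topologicalClosure : Set (GNSProd A B)) :=
  StarSubalgebra.isClosed_topologicalClosure _

instance instCStarMinTensor : CStarAlgebra (MinTensor A B) :=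
  inferInstanceAs (CStarAlgebra (algTensorHom A B).range.topologicalClosure)

variable {A B}

/-- The elementary tensor `a ⊗ b` in the minimal tensor product. -/
def minTmul (a : A) (b : B) : MinTensor A B :=
  ⟨algTensorHom A B (a ⊗ₜ[ℂ] b),
    StarSubalgebra.le_topologicalClosure _ ⟨a ⊗ₜ[ℂ] b, rfl⟩⟩

infixl:100 " ⊗ₘ " => minTmul

end MinTensor

/-! ## Compact quantum groups -/

/-- A compact quantum group (in the sense of Woronowicz) with `A = C(𝔾)`: a unital C*-algebra `A`
with a unital *-homomorphism `Δ : A → A ⊗ A` (minimal tensor product) that is coassociative and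
satisfies the cancellation property. -/
structure CompactQuantumGroup (A : Type u) [CStarAlgebra A] where
  /-- The comultiplication `Δ`. -/
  comul : A →⋆ₐ[ℂ] MinTensor A A
  /-- `(Δ ⊗ ι)Δ = (ι ⊗ Δ)Δ`. Here `F = Δ ⊗ ι`, `G = ι ⊗ Δ` and the canonical identification `α` of
  the two triple tensor products are the *-homomorphisms determined by their values on elementary
  tensors. -/
  coassoc : ∃ (F : MinTensor A A →⋆ₐ[ℂ] MinTensor (MinTensor A A) A)
      (G : MinTensor A A →⋆ₐ[ℂ] MinTensor A (MinTensor A A))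
      (α : MinTensor (MinTensor A A) A ≃⋆ₐ[ℂ] MinTensor A (MinTensor A A)),
    (∀ a b, F (a ⊗ₘ b) = comul a ⊗ₘ b) ∧ (∀ a b, G (a ⊗ₘ b) = a ⊗ₘ comul b) ∧
    (∀ a b c, α ((a ⊗ₘ b) ⊗ₘ c) = a ⊗ₘ (b ⊗ₘ c)) ∧ ∀ a, α (F (comul a)) = G (comul a)
  /-- `(A ⊗ 1)Δ(A)` spans a dense subspace. -/
  dense_left : Dense (Submodule.span ℂ {x | ∃ a b, x = (a ⊗ₘ 1) * comul b} : Set (MinTensor A A))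
  /-- `(1 ⊗ A)Δ(A)` spans a dense subspace. -/
  dense_right : Dense (Submodule.span ℂ {x | ∃ a b, x = (1 ⊗ₘ a) * comul b} : Set (MinTensor A A))

/-! ## Finite dimensional representations

After the choice of an orthonormal basis of the underlying finite dimensional Hilbert space `H`, an
element of `B(H) ⊗ A` is a matrix over `A`, and `T ∈ B(H)` is a complex matrix. In the dual basis of
the conjugate space `H̄ = H*`, the canonical anti-isomorphism `j : B(H) → B(H̄)`, which sends an
operator to its dual, is the transpose; and `H` is identified with its second dual. -/

section Representations

variable {A : Type u} [CStarAlgebra A]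
variable {m : Type v} {n : Type w} [Fintype m] [DecidableEq m] [Fintype n] [DecidableEq n]

/-- A finite dimensional unitary representation of a compact quantum group: a unitary
`U = (u i j)` in `Mₙ(A)` with `(ι ⊗ Δ)(U) = U₁₂ U₁₃`, that is
`Δ(u i j) = ∑ k, u i k ⊗ u k j`. -/
structure UnitaryRep (𝔾 : CompactQuantumGroup A) (n : Type w) [Fintype n] [DecidableEq n] where
  mat : Matrix n n A
  mem_unitary : mat ∈ unitary (Matrix n n A)
  comul_apply : ∀ i j, 𝔾.comul (mat i j) = ∑ k, mat i k ⊗ₘ mat k j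

/-- The matrix `T ⊗ 1` over `A` of a scalar matrix `T`. -/
def scalar (A : Type u) [CStarAlgebra A] (T : Matrix m n ℂ) : Matrix m n A :=
  T.map (algebraMap ℂ A)

/-- `T ∈ Mor(U, V)`: `T` is an intertwiner, `(T ⊗ 1) U = V (T ⊗ 1)`. -/
def IsMor (U : Matrix n n A) (V : Matrix m m A) (T : Matrix m n ℂ) : Prop :=
  scalar A T * U = V * scalar A T

/-- `U` and `V` are equivalent: there is an invertible intertwiner in `Mor(U, V)`. -/
def Equivalent (U : Matrix n n A) (V : Matrix m m A) : Prop :=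
  ∃ (T : Matrix m n ℂ) (S : Matrix n m ℂ), T * S = 1 ∧ S * T = 1 ∧ IsMor U V T

/-- The contragredient representation `Uᶜ = (j ⊗ ι)(U⁻¹)` of a representation `U`. -/
def contragredient (U : Matrix n n A) : Matrix n n A :=
  (Ring.inverse U).transpose

/-- `ρ` is the operator `ρ_U` of `U`: the (unique) positive invertible element of `Mor(U, Uᶜᶜ)` such
that `Tr(T ρ) = Tr(T ρ⁻¹)` for all `T ∈ End(U)`. -/
structure IsRho (U : Matrix n n A) (ρ : Matrix n n ℂ) : Prop where
  posDef : ρ.PosDef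
  isMor : IsMor U (contragredient (contragredient U)) ρ
  trace_eq : ∀ T : Matrix n n ℂ, IsMor U U T → (T * ρ).trace = (T * ρ⁻¹).trace

/-- The conjugate representation
`Ū = (j(ρ_U)^{1/2} ⊗ 1) Uᶜ (j(ρ_U)^{-1/2} ⊗ 1)` of `U`, where `ρ = ρ_U`. -/
def conjugate (U : Matrix n n A) (ρ : Matrix n n ℂ) : Matrix n n A :=
  scalar A (CFC.sqrt ρ.transpose) * contragredient U * scalar A (CFC.sqrt ρ.transpose)⁻¹

/-- `ρ` has symmetric eigenvalues: the eigenvalues of `ρ` and those of `ρ⁻¹`, each listed with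
multiplicities in descending order, coincide. -/
def HasSymmetricEigenvalues (ρ : Matrix n n ℂ) (hρ : ρ.PosDef) : Prop :=
  hρ.isHermitian.eigenvalues₀ = hρ.inv.isHermitian.eigenvalues₀

end Representations

end CQG

end

namespace CQG

open Matrix

/-! ### Positive definite matrices and the functional `Tr(· ρ)` on a *-subalgebra. -/

section ScalarMatrices

variable {n : Type*} [Fintype n]

/-! Since `Ū` is similar to `Uᶜ` by a scalar matrix, the hypothesis gives an invertible `R ∈ Mor(U,
Uᶜ)`. Transporting `ρ` along it yields `X = R⁻¹ (ρ⁻¹)ᵀ R ∈ Mor(U, Uᶜᶜ)` with `Tr(d X) = Tr(d X⁻¹)`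
on `End(U)`. As `R` need not be unitary, `X` need not be positive, so uniqueness of `ρ` does not
give `X = ρ`.

Instead `c = ρ⁻¹ X` lies in `End(U)`. The trace condition makes `ρ` commute with `End(U)`
(`commute_of_trace_eq`) and forces `c = c⁻¹` (`eq_of_trace_eq`), hence `X² = ρ²`. So `R` intertwines
`ρ²` and the square of `(ρ⁻¹)ᵀ`. By positivity it intertwines `ρ` and `(ρ⁻¹)ᵀ` themselves
(`intertwine_of_sq`), so `ρ` and `ρ⁻¹` have the same characteristic polynomial. -/

theorem eq_zero_of_trace_conjTranspose_mul_mul_eq_zero {P X : Matrix n n ℂ} (hP : P.PosDef)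
    (h : (Xᴴ * P * X).trace = 0) : X = 0 := by
  have h0 := (hP.posSemidef.conjTranspose_mul_mul_same X).trace_eq_zero_iff.mp h
  have hx : ∀ x, X *ᵥ x = 0 := fun x => by
    by_contra hne
    have hpos := hP.dotProduct_mulVec_pos hne
    have : star (X *ᵥ x) ⬝ᵥ (P *ᵥ (X *ᵥ x)) = star x ⬝ᵥ ((Xᴴ * P * X) *ᵥ x) := by
      simp only [star_mulVec, ← mulVec_mulVec, dotProduct_mulVec, vecMul_vecMul]
    rw [this, h0] at hpos
    simp at hpos
  classical
  exact Matrix.ext_of_mulVec_single fun i => by rw [hx, zero_mulVec]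

variable [DecidableEq n]

/-- A matrix that intertwines the squares of two positive definite matrices intertwines the
matrices themselves. -/
theorem intertwine_of_sq {P Q E : Matrix n n ℂ} (hP : P.PosDef) (hQ : Q.PosDef)
    (h : P * P * E = E * (Q * Q)) : P * E = E * Q := by
  rw [← sub_eq_zero]
  set F := P * E - E * Q with hF
  -- This Sylvester equation has only the zero solution: multiplying by `Fᴴ` and taking the trace
  -- gives two nonnegative terms with sum zero.
  have hs : P * F + F * Q = 0 := by
    rw [hF]
    linear_combination (norm := noncomm_ring) h
  have h1 := (hP.posSemidef.conjTranspose_mul_mul_same F).trace_nonneg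
  have h2 := (hQ.posSemidef.mul_mul_conjTranspose_same F).trace_nonneg
  have h3 : (Fᴴ * P * F).trace + (F * Q * Fᴴ).trace = 0 := by
    rw [Matrix.trace_mul_comm (F * Q), ← Matrix.trace_add, mul_assoc, ← mul_add, hs, mul_zero,
      Matrix.trace_zero]
  exact eq_zero_of_trace_conjTranspose_mul_mul_eq_zero hP
    ((add_eq_zero_iff_of_nonneg h1 h2).mp h3).1

variable {D : StarSubalgebra ℂ (Matrix n n ℂ)} {ρ : Matrix n n ℂ}

/-- Faithfulness of `d ↦ Tr(d ρ)` on `D`: test with `d = w*`. -/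
theorem eq_zero_of_forall_trace_eq_zero (hρ : ρ.PosDef) {w : Matrix n n ℂ} (hw : w ∈ D)
    (h : ∀ d ∈ D, (d * w * ρ).trace = 0) : w = 0 := by
  have h1 := h _ (star_mem hw)
  rw [Matrix.trace_mul_comm, ← mul_assoc, Matrix.trace_mul_comm, ← mul_assoc,
    star_eq_conjTranspose] at h1
  have := eq_zero_of_trace_conjTranspose_mul_mul_eq_zero (X := wᴴ) hρ (by simpa using h1)
  simpa using this

/-- Let `σ(z) = ρ⁻¹ z ρ`, an automorphism of `D`. Evaluating `Tr(d σ(z) ρ⁻¹)` in two ways, by the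
trace condition and cyclicity, gives `σ²(z) = z`. So `ρ²` commutes with `z`, and then so does its
positive root `ρ`. -/
theorem commute_of_trace_eq (hρ : ρ.PosDef) (hD : ∀ d ∈ D, ρ⁻¹ * d * ρ ∈ D)
    (htr : ∀ d ∈ D, (d * ρ).trace = (d * ρ⁻¹).trace) {z : Matrix n n ℂ} (hz : z ∈ D) :
    ρ * z = z * ρ := by
  have hu : IsUnit ρ.det := (isUnit_iff_isUnit_det _).mp hρ.isUnit
  have e1 : ρ * ρ⁻¹ = 1 := mul_nonsing_inv _ hu
  have e2 : ρ⁻¹ * ρ = 1 := nonsing_inv_mul _ hu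
  have key : ∀ x ∈ D, ∀ d ∈ D, (d * x * ρ⁻¹).trace = (d * ρ * (ρ⁻¹ * x * ρ)).trace := by
    intro x hx d hd
    rw [← htr _ (mul_mem hd hx)]
    congr 1
    calc d * x * ρ = d * 1 * x * ρ := by rw [mul_one]
      _ = _ := by rw [← e1]; noncomm_ring
  set y := ρ⁻¹ * z * ρ with hy
  have hyD : y ∈ D := hD z hz
  set x := ρ⁻¹ * y * ρ with hx
  have hxD : x ∈ D := hD y hyD
  have hρy : ρ * y = z * ρ := by rw [hy, ← mul_assoc, ← mul_assoc, e1, one_mul]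
  have hρx : ρ * x = y * ρ := by rw [hx, ← mul_assoc, ← mul_assoc, e1, one_mul]
  have hyρ : y * ρ⁻¹ = ρ⁻¹ * z := by rw [hy, mul_assoc, e1, mul_one]
  have hzx : z - x = 0 := by
    have hw : star (z - x) ∈ D := star_mem (sub_mem hz hxD)
    refine eq_zero_of_trace_conjTranspose_mul_mul_eq_zero hρ ?_
    rw [← star_eq_conjTranspose]
    set d := star (z - x)
    have h1 : (d * y * ρ⁻¹).trace = (d * ρ * x).trace := key y hyD d hw
    -- Here `y ρ⁻¹ = ρ⁻¹ z`; the trace condition is applied to `z d` after a cyclic shift.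
    have h2 : (d * y * ρ⁻¹).trace = (d * ρ * z).trace := by
      rw [mul_assoc, hyρ, ← mul_assoc, Matrix.trace_mul_comm, ← mul_assoc,
        ← htr _ (mul_mem hz hw), mul_assoc, Matrix.trace_mul_comm]
    rw [mul_sub, Matrix.trace_sub, ← h1, h2, sub_self]
  have hzx' : x = z := (sub_eq_zero.mp hzx).symm
  refine intertwine_of_sq hρ hρ ?_
  rw [mul_assoc, ← hzx', hρx, ← mul_assoc, hρy, hzx', mul_assoc]

theorem eq_of_trace_eq (hρ : ρ.PosDef) (hD : ∀ d ∈ D, ρ⁻¹ * d * ρ ∈ D)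
    (htr : ∀ d ∈ D, (d * ρ).trace = (d * ρ⁻¹).trace) {c c' : Matrix n n ℂ} (hc : c ∈ D)
    (hc' : c' ∈ D) (h : ∀ d ∈ D, (d * (ρ * c)).trace = (d * (c' * ρ⁻¹)).trace) : c = c' := by
  rw [← sub_eq_zero]
  refine eq_zero_of_forall_trace_eq_zero hρ (sub_mem hc hc') fun d hd => ?_
  have := h d hd
  rw [commute_of_trace_eq hρ hD htr hc, ← mul_assoc, ← mul_assoc, ← htr _ (mul_mem hd hc')] at this
  rw [mul_sub, sub_mul, Matrix.trace_sub, this, sub_self]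

end ScalarMatrices

/-! ### Scalar matrices over `A` and composition of intertwiners. -/

section Scalar

variable {A : Type*} [CStarAlgebra A] {n : Type*}

theorem scalar_one [DecidableEq n] : scalar A (1 : Matrix n n ℂ) = 1 :=
  Matrix.map_one _ (map_zero _) (map_one _)

theorem star_scalar (S : Matrix n n ℂ) : star (scalar A S) = scalar A (star S) := by
  ext i j
  simp only [scalar, Matrix.star_apply, Matrix.map_apply, algebraMap_star_comm]

variable [Fintype n]

theorem scalar_mul (S T : Matrix n n ℂ) : scalar A (S * T) = scalar A S * scalar A T :=
  Matrix.map_mul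

theorem transpose_scalar_mul (S : Matrix n n ℂ) (V : Matrix n n A) :
    (scalar A S * V).transpose = V.transpose * scalar A S.transpose := by
  ext i j
  simp [scalar, Matrix.mul_apply, Algebra.commutes]

theorem transpose_mul_scalar (S : Matrix n n ℂ) (V : Matrix n n A) :
    (V * scalar A S).transpose = scalar A S.transpose * V.transpose := by
  ext i j
  simp [scalar, Matrix.mul_apply, Algebra.commutes]

theorem IsMor.comp {V W Z : Matrix n n A} {S T : Matrix n n ℂ} (hS : IsMor W Z S)
    (hT : IsMor V W T) : IsMor V Z (S * T) := by
  rw [IsMor, scalar_mul, mul_assoc, hT, ← mul_assoc, hS, mul_assoc]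

end Scalar

/-! ### Intertwiners, contragredients and the proof of symmetry. -/

section Representations

variable {A : Type*} [CStarAlgebra A] {n : Type*} [Fintype n] [DecidableEq n]

theorem scalar_mul_eq_one {P Q : Matrix n n ℂ} (h : P * Q = 1) : scalar A P * scalar A Q = 1 := by
  rw [← scalar_mul, h, scalar_one]

/-- `P V P⁻¹` is contragredient to `(Pᵀ)⁻¹ Vᶜ Pᵀ`. -/
theorem contragredient_conj {P Q : Matrix n n ℂ} (hPQ : P * Q = 1) (V : Matrix n n A) :
    contragredient (scalar A P * V * scalar A Q) =
      scalar A Q.transpose * contragredient V * scalar A P.transpose := by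
  have hQP : Q * P = 1 := mul_eq_one_comm.mp hPQ
  let p : (Matrix n n A)ˣ :=
    ⟨scalar A P, scalar A Q, scalar_mul_eq_one hPQ, scalar_mul_eq_one hQP⟩
  have hP : IsUnit (scalar A P) := p.isUnit
  have hQ : IsUnit (scalar A Q) := p⁻¹.isUnit
  have iP : Ring.inverse (scalar A P) = scalar A Q := Ring.inverse_unit p
  have iQ : Ring.inverse (scalar A Q) = scalar A P := Ring.inverse_unit p⁻¹
  rw [contragredient, Ring.inverse_mul (Or.inr hQ), Ring.inverse_mul (Or.inl hP), iP, iQ,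
    transpose_scalar_mul, transpose_mul_scalar, contragredient]

theorem isMor_iff_conj_eq {V W : Matrix n n A} {P Q : Matrix n n ℂ} (hPQ : P * Q = 1) :
    IsMor V W P ↔ W = scalar A P * V * scalar A Q := by
  have e1 : scalar A P * scalar A Q = 1 := scalar_mul_eq_one hPQ
  have e2 : scalar A Q * scalar A P = 1 := scalar_mul_eq_one (mul_eq_one_comm.mp hPQ)
  constructor
  · intro h
    rw [h, mul_assoc, e1, mul_one]
  · rintro rfl
    rw [IsMor, mul_assoc _ (scalar A Q), e2, mul_one]

theorem IsMor.inv {V W : Matrix n n A} {P Q : Matrix n n ℂ} (hPQ : P * Q = 1)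
    (h : IsMor V W P) : IsMor W V Q := by
  have e1 : scalar A P * scalar A Q = 1 := scalar_mul_eq_one hPQ
  have e2 : scalar A Q * scalar A P = 1 := scalar_mul_eq_one (mul_eq_one_comm.mp hPQ)
  rw [(isMor_iff_conj_eq hPQ).mp h, IsMor, ← mul_assoc, ← mul_assoc, e2, one_mul]

theorem IsMor.contragredient {V W : Matrix n n A} {P Q : Matrix n n ℂ} (hPQ : P * Q = 1)
    (h : IsMor V W P) : IsMor (contragredient V) (contragredient W) Q.transpose := by
  have : Q.transpose * P.transpose = 1 := by rw [← transpose_mul, hPQ, transpose_one]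
  rw [isMor_iff_conj_eq this, (isMor_iff_conj_eq hPQ).mp h, contragredient_conj hPQ]

theorem IsMor.contragredient_self {V : Matrix n n A} {T : Matrix n n ℂ} (h : IsMor V V T) :
    IsMor (CQG.contragredient V) (CQG.contragredient V) T.transpose := by
  have h1 : scalar A T * Ring.inverse V = Ring.inverse V * scalar A T := by
    by_cases hV : IsUnit V
    · obtain ⟨v, rfl⟩ := hV
      rw [Ring.inverse_unit]
      exact (Commute.units_inv_right (u := v) h).eq
    · rw [Ring.inverse_non_unit _ hV, mul_zero, zero_mul]
  rw [IsMor, CQG.contragredient, ← transpose_mul_scalar, ← h1, transpose_scalar_mul]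

/-- Invertibility matters: for a non-unit `V`, `Ring.inverse V` is `0` and carries no information
about `V`. -/
theorem IsMor.of_contragredient_self {V : Matrix n n A} (hV : IsUnit V) {T : Matrix n n ℂ}
    (h : IsMor (CQG.contragredient V) (CQG.contragredient V) T) : IsMor V V T.transpose := by
  have h1 : scalar A T.transpose * Ring.inverse V = Ring.inverse V * scalar A T.transpose := by
    have := congrArg Matrix.transpose h
    rw [transpose_scalar_mul, transpose_mul_scalar, CQG.contragredient, transpose_transpose] at this
    exact this.symm
  obtain ⟨v, rfl⟩ := hV
  rw [Ring.inverse_unit] at h1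
  exact (Commute.units_inv_right_iff.mp h1).eq

/-- The *-algebra `End(U) = Mor(U, U)` of a unitary matrix `U` over `A`. -/
def endStarSubalgebra (U : Matrix n n A) (hU : U ∈ unitary (Matrix n n A)) :
    StarSubalgebra ℂ (Matrix n n ℂ) where
  carrier := {T | IsMor U U T}
  mul_mem' hS hT := hS.comp hT
  add_mem' {S T} hS hT := by
    have : scalar A (S + T) = scalar A S + scalar A T := Matrix.map_add _ (map_add _) S T
    change scalar A _ * U = U * scalar A _
    rw [this, add_mul, mul_add, hS, hT]
  algebraMap_mem' r := by
    change scalar A _ * U = U * scalar A _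
    have : scalar A (algebraMap ℂ (Matrix n n ℂ) r) = algebraMap ℂ (Matrix n n A) r := by
      ext i j
      simp [scalar, Matrix.algebraMap_matrix_apply, apply_ite (algebraMap ℂ A)]
    rw [this, Algebra.commutes]
  star_mem' {T} hT := by
    change scalar A _ * U = U * scalar A _
    rw [← star_scalar]
    have h : star U * star (scalar A T) = star (scalar A T) * star U := by
      rw [← star_mul, ← star_mul]
      exact congrArg star hT
    calc star (scalar A T) * U = U * (star U * star (scalar A T)) * U := by
          rw [← mul_assoc, Unitary.mul_star_self_of_mem hU, one_mul]
      _ = U * star (scalar A T) := by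
          rw [h, mul_assoc, mul_assoc, Unitary.star_mul_self_of_mem hU, mul_one]

theorem charpoly_eq_of_isMor_contragredient {U : Matrix n n A} (hU : U ∈ unitary (Matrix n n A))
    {ρ : Matrix n n ℂ} (hρ : IsRho U ρ) {R Q : Matrix n n ℂ} (hRQ : R * Q = 1)
    (hR : IsMor U (contragredient U) R) : ρ.charpoly = ρ⁻¹.charpoly := by
  have hQR : Q * R = 1 := mul_eq_one_comm.mp hRQ
  have hu : IsUnit ρ.det := (isUnit_iff_isUnit_det _).mp hρ.posDef.isUnit
  have e1 : ρ * ρ⁻¹ = 1 := mul_nonsing_inv _ hu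
  have e2 : ρ⁻¹ * ρ = 1 := nonsing_inv_mul _ hu
  have e3 : ρ⁻¹.transpose * ρ.transpose = 1 := by rw [← transpose_mul, e1, transpose_one]
  have hUu : IsUnit U := ⟨Unitary.toUnits ⟨U, hU⟩, rfl⟩
  set D := endStarSubalgebra U hU
  -- Two transposes put `d` in `End(Uᶜᶜ)`, and `ρ` carries it back to `End(U)`.
  have hDconj : ∀ d ∈ D, ρ⁻¹ * d * ρ ∈ D := fun d hd =>
    ((hρ.isMor.inv e1).comp (by
      simpa using (IsMor.contragredient_self hd).contragredient_self)).comp hρ.isMor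
  set X := Q * ρ⁻¹.transpose * R with hX
  set X' := Q * ρ.transpose * R with hX'
  have hXX' : X * X' = 1 := by
    calc X * X' = Q * ρ⁻¹.transpose * (R * Q) * ρ.transpose * R := by
          rw [hX, hX']; noncomm_ring
      _ = 1 := by rw [hRQ, mul_one, mul_assoc Q, e3, mul_one, hQR]
  -- The path is `U → Uᶜ → Uᶜᶜᶜ → Uᶜᶜ`, by `R`, `(ρ⁻¹)ᵀ` and `R⁻¹`.
  have hXmor : IsMor U (contragredient (contragredient U)) X := by
    have hQt : Q.transpose * R.transpose = 1 := by rw [← transpose_mul, hRQ, transpose_one]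
    have h1 : IsMor (contragredient (contragredient U))
        (contragredient (contragredient (contragredient U))) R := by
      simpa using (hR.contragredient hRQ).contragredient hQt
    exact ((h1.inv hRQ).comp (hρ.isMor.contragredient e1)).comp hR
  set c := ρ⁻¹ * X with hc
  set c' := X' * ρ with hc'
  have hcc' : c * c' = 1 := by
    calc c * c' = ρ⁻¹ * (X * X') * ρ := by rw [hc, hc']; noncomm_ring
      _ = 1 := by rw [hXX', mul_one, e2]
  have hcD : IsMor U U c := (hρ.isMor.inv e1).comp hXmor
  have hcD' : IsMor U U c' := hcD.inv hcc'
  have htr : ∀ d ∈ D, (d * ρ).trace = (d * ρ⁻¹).trace := fun d hd => hρ.trace_eq d hd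
  have hXtr : ∀ d ∈ D, (d * X).trace = (d * X').trace := by
    intro d hd
    -- `d ↦ (R d R⁻¹)ᵀ` maps `End(U)` to itself and turns the trace condition for `X` into that for
    -- `ρ`.
    have he : IsMor U U (R * d * Q).transpose :=
      IsMor.of_contragredient_self hUu ((hR.comp hd).comp (hR.inv hRQ))
    have key : ∀ S : Matrix n n ℂ,
        (d * (Q * S.transpose * R)).trace = ((R * d * Q).transpose * S).trace := fun S => by
      rw [← mul_assoc, Matrix.trace_mul_comm, ← mul_assoc, ← mul_assoc, ← trace_transpose,
        transpose_mul, transpose_transpose, Matrix.trace_mul_comm]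
    rw [hX, hX', key, key, hρ.trace_eq _ he]
  have hρc : ρ * c = X := by rw [hc, ← mul_assoc, e1, one_mul]
  have hcρ : c' * ρ⁻¹ = X' := by rw [hc', mul_assoc, e1, mul_one]
  have hceq : c = c' := eq_of_trace_eq hρ.posDef hDconj htr hcD hcD' fun d hd => by
    rw [hρc, hcρ, hXtr d hd]
  have hcomm : ρ * c = c * ρ := commute_of_trace_eq hρ.posDef hDconj htr hcD
  have hXX : X * X = ρ * ρ := by
    calc X * X = ρ * c * (ρ * c) := by rw [hρc]
      _ = ρ * (c * c) * ρ := by nth_rw 2 [hcomm]; noncomm_ring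
      _ = ρ * ρ := by nth_rw 2 [hceq]; rw [hcc', mul_one]
  have hsq : ρ⁻¹.transpose * ρ⁻¹.transpose * R = R * (ρ * ρ) := by
    calc ρ⁻¹.transpose * ρ⁻¹.transpose * R
        = (R * Q) * ρ⁻¹.transpose * (R * Q) * ρ⁻¹.transpose * R := by rw [hRQ, one_mul, mul_one]
      _ = R * (X * X) := by rw [hX]; noncomm_ring
      _ = R * (ρ * ρ) := by rw [hXX]
  -- Positivity of `ρ` and `(ρ⁻¹)ᵀ` compensates for the possible non-positivity of `X`.
  have hfin := intertwine_of_sq hρ.posDef.inv.transpose hρ.posDef hsq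
  calc ρ.charpoly = (Q * (R * ρ)).charpoly := by rw [← mul_assoc, hQR, one_mul]
    _ = ρ⁻¹.charpoly := by
      rw [← hfin, charpoly_mul_comm, mul_assoc, hRQ, mul_one, charpoly_transpose]

theorem exists_isMor_contragredient {U : Matrix n n A} {ρ : Matrix n n ℂ} (hρ : ρ.PosDef)
    (h : Equivalent U (conjugate U ρ)) :
    ∃ R Q : Matrix n n ℂ, R * Q = 1 ∧ IsMor U (contragredient U) R := by
  obtain ⟨T, T', hT, -, hmor⟩ := h
  set S := CFC.sqrt ρ.transpose with hS
  have hSS : S * S = ρ.transpose :=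
    CFC.sqrt_mul_sqrt_self _ (Matrix.nonneg_iff_posSemidef.mpr hρ.transpose.posSemidef)
  have hSu : IsUnit S.det := by
    have := (isUnit_iff_isUnit_det _).mp hρ.transpose.isUnit
    rw [← hSS, det_mul] at this
    exact isUnit_of_mul_isUnit_left this
  have e1 : S * S⁻¹ = 1 := mul_nonsing_inv _ hSu
  have e2 : S⁻¹ * S = 1 := nonsing_inv_mul _ hSu
  have hSmor : IsMor (contragredient U) (conjugate U ρ) S := (isMor_iff_conj_eq e1).mpr rfl
  refine ⟨S⁻¹ * T, T' * S, ?_, (hSmor.inv e1).comp hmor⟩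
  rw [mul_assoc, ← mul_assoc T, hT, one_mul, e2]

end Representations

end CQG

theorem proposition3p1 {A : Type*} [CStarAlgebra A] (𝔾 : CQG.CompactQuantumGroup A)
    {n : Type*} [Fintype n] [DecidableEq n] (U : CQG.UnitaryRep 𝔾 n)
    (ρ : Matrix n n ℂ) (hρ : CQG.IsRho U.mat ρ)
    (hU : CQG.Equivalent U.mat (CQG.conjugate U.mat ρ)) :
    CQG.HasSymmetricEigenvalues ρ hρ.posDef := by
  obtain ⟨R, Q, hRQ, hR⟩ := CQG.exists_isMor_contragredient hρ.posDef hU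
  have h := CQG.charpoly_eq_of_isMor_contragredient U.mem_unitary hρ hRQ hR
  -- The ordered eigenvalues are the sorted roots of the characteristic polynomial.
  rw [CQG.HasSymmetricEigenvalues, ← List.ofFn_inj,
    ← Matrix.IsHermitian.sort_roots_charpoly_eq_eigenvalues₀,
    ← Matrix.IsHermitian.sort_roots_charpoly_eq_eigenvalues₀, h]
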